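/- For $k=0,1,2,\dots$ let $h_k(x)=\left(\pi^{1/2}2^k k!\right)^{-1/2}e^{-x^2/2}H_k(x)$ be the normalized Hermite functions on $\mathbb{R}$, where $H_k(x)=(-1)^k e^{x^2}\frac{d^k}{dx^k}e^{-x^2}$ are the Hermite polynomials. Fix $b>0$, put $a_k=h_k(b)$, and for integers $n\ge 0$ let $$\widetilde{\sigma}(n)=\sum_{\substack{k\ge 0\\ n-k\ \mathrm{odd}}}\frac{a_k^2}{n-k}.$$ These series converge absolutely, and $$\widetilde{\sigma}(n)=\frac{(-1)^{n+1}}{2}\,\frac{\sin\left(2b\sqrt{2n}\right)}{\sqrt{2n}}+\rho(n),\qquad |\rho(n)|\le C\,\frac{\log n}{n}\quad (n\ge 2),$$ with a constant $C$ that depends only on $b$; that is, the error term is $O\left(\frac{\log n}{n}\right)$ as $n\to\infty$ for fixed $b$. -/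

import Mathlib

open Real

/-- The (physicists') Hermite polynomial as a function on `ℝ`, through the Rodrigues formula
`H_n(x) = (-1)^n e^{x²} (d/dx)^n e^{-x²}`. -/
noncomputable def hermiteH (n : ℕ) (x : ℝ) : ℝ :=
  (-1) ^ n * exp (x ^ 2) * iteratedDeriv n (fun y : ℝ => exp (-y ^ 2)) x

/-- The `L²(ℝ)`-normalized Hermite function
`h_n(x) = (π^{1/2} 2^n n!)^{-1/2} e^{-x²/2} H_n(x)`. -/
noncomputable def hermiteFun (n : ℕ) (x : ℝ) : ℝ :=
  (√(√π * 2 ^ n * (n.factorial : ℝ)))⁻¹ * exp (-x ^ 2 / 2) * hermiteH n x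

/-- The `k`-th term of `σ̃(n)`: `a_k² / (n - k)` with `a_k = h_k(b)` if `n - k` is odd,
and `0` otherwise. -/
noncomputable def sigmaTildeTerm (b : ℝ) (n k : ℕ) : ℝ :=
  if Odd ((n : ℤ) - (k : ℤ)) then hermiteFun k b ^ 2 / ((n : ℝ) - (k : ℝ)) else 0

/-- `σ̃(n) = ∑_{k ≥ 0, n - k odd} a_k² / (n - k)`, where `a_k = h_k(b)`. -/
noncomputable def sigmaTilde (b : ℝ) (n : ℕ) : ℝ :=
  ∑' k : ℕ, sigmaTildeTerm b n k

/-! The sum is a diagonal value of a Green function. Write V_n = e^{-x²/2} H_n and let U_n be a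
second solution of y'' = (x² - 2n - 1) y, of parity opposite to V_n. On functions of parity opposite
to n, the energy 2n + 1 is not an eigenvalue of the oscillator, so there is a Green function G with
pole b. It is glued from U_n on (-b, b] and ±V_n outside. Green's identity and the Wronskian U_{n+1}
V_n - U_n V_{n+1} = -2^n n! give its coefficients: -2^n n! h_k(b)/(n - k) for n - k odd, and 0
otherwise. Expanding G in Hermite functions and evaluating at b yields the closed form σ̃(n) =
-U_n(b) V_n(b)/(2^n n!) (`sigmaTilde_eq`). An L² expansion has no pointwise values, so Parseval is
applied to averages over (b, b + ε], and ε → 0 by dominated convergence.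

For fixed b and large n the equation on [0, b] is a small perturbation of y'' = -2n y. Of U_n and
V_n the even one is close to a cosine and the odd one to a sine of frequency √(2n). Their product is
half a sine of 2b√(2n), with the amplitude fixed by the Wronskian at 0
(`abs_hermiteU_mul_hermiteV_sub_le`). This gives an error O(1/n), stronger than the required O(log n
/ n). -/

/-! ### Ladders of solutions of the Hermite equations. -/

/-- A sequence of functions on which `x - d/dx` acts as the raising operator `f n ↦ f (n + 1)` and
which satisfies the three-term recurrence of the Hermite functions. -/
structure IsHermiteLadder (f : ℕ → ℝ → ℝ) : Prop where
  hasDerivAt : ∀ n x, HasDerivAt (f n) (x * f n x - f (n + 1) x) x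
  recurrence : ∀ (n : ℕ) x, f (n + 2) x = 2 * x * f (n + 1) x - 2 * (n + 1) * f n x

/-- The sequence with the given first two terms which satisfies the Hermite recurrence. -/
noncomputable def hermiteRec (f₀ f₁ : ℝ → ℝ) : ℕ → ℝ → ℝ
  | 0 => f₀
  | 1 => f₁
  | n + 2 => fun x => 2 * x * hermiteRec f₀ f₁ (n + 1) x - 2 * (n + 1) * hermiteRec f₀ f₁ n x

/-- Differentiating the recurrence propagates the raising rule, so only the first two members need a
check. -/
theorem isHermiteLadder_hermiteRec {f₀ f₁ : ℝ → ℝ}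
    (h₀ : ∀ x, HasDerivAt f₀ (x * f₀ x - f₁ x) x)
    (h₁ : ∀ x, HasDerivAt f₁ (2 * f₀ x - x * f₁ x) x) :
    IsHermiteLadder (hermiteRec f₀ f₁) := by
  have hrec : ∀ (n : ℕ) x, hermiteRec f₀ f₁ (n + 2) x =
      2 * x * hermiteRec f₀ f₁ (n + 1) x - 2 * (n + 1) * hermiteRec f₀ f₁ n x :=
    fun n x => by simp [hermiteRec]
  refine ⟨fun n => ?_, hrec⟩
  induction n using Nat.twoStepInduction with
  | zero => exact h₀
  | one =>
    intro x
    refine (h₁ x).congr_deriv ?_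
    rw [hrec]
    simp only [hermiteRec]
    push_cast
    ring
  | more n ih₀ ih₁ =>
    intro x
    have h := (((hasDerivAt_id x).const_mul 2).mul (ih₁ x)).sub ((ih₀ x).const_mul (2 * ((n : ℝ) + 1)))
    refine HasDerivAt.congr_deriv (h.congr_of_eventuallyEq (.of_forall fun y => ?_)) ?_
    · simp [hrec]
    · have e1 := hrec (n + 1) x
      have e0 := hrec n x
      push_cast at e1
      simp only [id, mul_one]
      rw [show n + 2 + 1 = n + 1 + 2 by ring, e1, show n + 1 + 1 = n + 2 by ring, e0]
      ring

namespace IsHermiteLadder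

variable {f g : ℕ → ℝ → ℝ}

theorem continuous (hf : IsHermiteLadder f) (n : ℕ) : Continuous (f n) :=
  continuous_iff_continuousAt.2 fun x => (hf.hasDerivAt n x).continuousAt

/-- Since f_n' = x f_n - f_{n+1}, this is the oscillator equation at energy 2n + 1. In particular
f_n'(0) = -f_{n+1}(0), which is how initial data are recorded below. -/
theorem hasDerivAt_deriv (hf : IsHermiteLadder f) (n : ℕ) (x : ℝ) :
    HasDerivAt (fun y => y * f n y - f (n + 1) y) ((x ^ 2 - (2 * n + 1)) * f n x) x := by
  refine (((hasDerivAt_id x).mul (hf.hasDerivAt n x)).sub (hf.hasDerivAt (n + 1) x)).congr_deriv ?_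
  simp only [id]
  rw [show n + 1 + 1 = n + 2 by ring, hf.recurrence]
  ring

theorem wronskian (hf : IsHermiteLadder f) (hg : IsHermiteLadder g) (n : ℕ) (x : ℝ) :
    f (n + 1) x * g n x - f n x * g (n + 1) x =
      2 ^ n * n.factorial * (f 1 x * g 0 x - f 0 x * g 1 x) := by
  induction n with
  | zero => simp
  | succ n ih =>
    rw [show n + 1 + 1 = n + 2 by ring, hf.recurrence, hg.recurrence, Nat.factorial_succ]
    push_cast
    linear_combination (2 * ((n : ℝ) + 1)) * ih

/-- The derivative of the Wronskian of solutions for two different energy levels. -/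
theorem hasDerivAt_wronskian (hf : IsHermiteLadder f) (hg : IsHermiteLadder g) (n k : ℕ) (x : ℝ) :
    HasDerivAt (fun y => f n y * (y * g k y - g (k + 1) y) - (y * f n y - f (n + 1) y) * g k y)
      (2 * ((n : ℝ) - k) * (f n x * g k x)) x := by
  refine (((hf.hasDerivAt n x).mul (hg.hasDerivAt_deriv k x)).sub
    ((hf.hasDerivAt_deriv n x).mul (hg.hasDerivAt k x))).congr_deriv ?_
  ring

theorem neg_apply (hf : IsHermiteLadder f) {s : ℝ} (h₀ : ∀ x, f 0 (-x) = s * f 0 x)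
    (h₁ : ∀ x, f 1 (-x) = -s * f 1 x) (n : ℕ) (x : ℝ) : f n (-x) = s * (-1) ^ n * f n x := by
  induction n using Nat.twoStepInduction with
  | zero => simp [h₀]
  | one => simp [h₁]
  | more n ih₀ ih₁ =>
    rw [hf.recurrence, hf.recurrence, ih₀, ih₁]
    ring

end IsHermiteLadder

/-! ### The two families of solutions: parity, Wronskian, normalization. -/

/-- The unnormalized Hermite functions `e^{-x²/2} H_n(x)`. -/
noncomputable def hermiteV : ℕ → ℝ → ℝ :=
  hermiteRec (fun x => exp (-x ^ 2 / 2)) (fun x => 2 * x * exp (-x ^ 2 / 2))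

theorem hasDerivAt_exp_neg_sq_div_two (x : ℝ) :
    HasDerivAt (fun y : ℝ => exp (-y ^ 2 / 2)) (-x * exp (-x ^ 2 / 2)) x := by
  refine ((((hasDerivAt_id x).pow 2).neg.div_const 2).exp).congr_deriv ?_
  simp only [id, Pi.neg_apply, Pi.pow_apply]
  norm_num
  ring

theorem hasDerivAt_exp_sq_div_two (x : ℝ) :
    HasDerivAt (fun y : ℝ => exp (y ^ 2 / 2)) (x * exp (x ^ 2 / 2)) x := by
  refine ((((hasDerivAt_id x).pow 2).div_const 2).exp).congr_deriv ?_
  simp only [id, Pi.pow_apply]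
  norm_num
  ring

theorem isHermiteLadder_hermiteV : IsHermiteLadder hermiteV := by
  refine isHermiteLadder_hermiteRec (fun x => ?_) (fun x => ?_)
  · refine (hasDerivAt_exp_neg_sq_div_two x).congr_deriv ?_
    ring
  · refine (((hasDerivAt_id x).const_mul 2).mul (hasDerivAt_exp_neg_sq_div_two x)).congr_deriv ?_
    simp only [id]
    ring

/-- A second family of solutions of the Hermite equations `-y'' + x² y = (2n + 1) y`. -/
noncomputable def hermiteU : ℕ → ℝ → ℝ :=
  hermiteRec (fun x => exp (-x ^ 2 / 2) * ∫ t in (0 : ℝ)..x, exp (t ^ 2))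
    (fun x => 2 * x * (exp (-x ^ 2 / 2) * ∫ t in (0 : ℝ)..x, exp (t ^ 2)) - exp (x ^ 2 / 2))

theorem isHermiteLadder_hermiteU : IsHermiteLadder hermiteU := by
  have h₀ (x : ℝ) : HasDerivAt (fun x : ℝ => exp (-x ^ 2 / 2) * ∫ t in (0 : ℝ)..x, exp (t ^ 2))
      (-x * (exp (-x ^ 2 / 2) * ∫ t in (0 : ℝ)..x, exp (t ^ 2)) + exp (x ^ 2 / 2)) x := by
    have hc : Continuous fun t : ℝ => exp (t ^ 2) := by fun_prop
    have hi : HasDerivAt (fun x : ℝ => ∫ t in (0 : ℝ)..x, exp (t ^ 2)) (exp (x ^ 2)) x :=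
      intervalIntegral.integral_hasDerivAt_right (hc.intervalIntegrable _ _)
        (hc.stronglyMeasurableAtFilter _ _) hc.continuousAt
    refine ((hasDerivAt_exp_neg_sq_div_two x).mul hi).congr_deriv ?_
    have : exp (-x ^ 2 / 2) * exp (x ^ 2) = exp (x ^ 2 / 2) := by
      rw [← exp_add]
      congr 1
      ring
    linear_combination this
  refine isHermiteLadder_hermiteRec (fun x => ?_) (fun x => ?_)
  · refine (h₀ x).congr_deriv ?_
    ring
  · refine ((((hasDerivAt_id x).const_mul 2).mul (h₀ x)).sub
      (hasDerivAt_exp_sq_div_two x)).congr_deriv ?_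
    simp only [id]
    ring

theorem hermiteV_zero (x : ℝ) : hermiteV 0 x = exp (-x ^ 2 / 2) := by simp [hermiteV, hermiteRec]

theorem hermiteV_one (x : ℝ) : hermiteV 1 x = 2 * x * exp (-x ^ 2 / 2) := by
  simp [hermiteV, hermiteRec]

theorem hermiteV_neg (n : ℕ) (x : ℝ) : hermiteV n (-x) = (-1) ^ n * hermiteV n x := by
  rw [isHermiteLadder_hermiteV.neg_apply (s := 1) (fun x => by simp [hermiteV_zero])
    (fun x => by simp [hermiteV_one]), one_mul]

theorem hermiteU_neg (n : ℕ) (x : ℝ) : hermiteU n (-x) = -(-1) ^ n * hermiteU n x := by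
  have hI (x : ℝ) : ∫ t in (0 : ℝ)..(-x), exp (t ^ 2) = -∫ t in (0 : ℝ)..x, exp (t ^ 2) := by
    have := intervalIntegral.integral_comp_neg (a := 0) (b := x) fun t : ℝ => exp (t ^ 2)
    simp only [neg_zero, even_two, Even.neg_pow] at this
    rw [intervalIntegral.integral_symm, ← this]
  rw [isHermiteLadder_hermiteU.neg_apply (s := -1) (fun x => ?_) (fun x => ?_)]
  · ring
  · simp [hermiteU, hermiteRec, hI]
  · simp [hermiteU, hermiteRec, hI]

theorem hermiteU_hermiteV_wronskian (n : ℕ) (x : ℝ) :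
    hermiteU (n + 1) x * hermiteV n x - hermiteU n x * hermiteV (n + 1) x =
      -(2 ^ n * n.factorial) := by
  rw [isHermiteLadder_hermiteU.wronskian isHermiteLadder_hermiteV, hermiteV_zero, hermiteV_one]
  have : exp (x ^ 2 / 2) * exp (-x ^ 2 / 2) = 1 := by
    rw [← exp_add, ← exp_zero]
    congr 1
    ring
  simp only [hermiteU, hermiteRec]
  linear_combination (-(2 : ℝ) ^ n * n.factorial) * this

/-- Links the Rodrigues formula to the recurrence: by the raising rule, differentiating e^{-x²/2}
V_n gives -e^{-x²/2} V_{n+1}. -/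
theorem hermiteH_mul_exp (n : ℕ) (x : ℝ) : exp (-x ^ 2 / 2) * hermiteH n x = hermiteV n x := by
  have key : ∀ n : ℕ, iteratedDeriv n (fun y : ℝ => exp (-y ^ 2)) =
      fun x => (-1) ^ n * (exp (-x ^ 2 / 2) * hermiteV n x) := by
    intro n
    induction n with
    | zero =>
      ext x
      simp only [iteratedDeriv_zero, hermiteV_zero, pow_zero, one_mul, ← exp_add]
      congr 1
      ring
    | succ n ih =>
      rw [iteratedDeriv_succ, ih]
      ext x
      refine (((hasDerivAt_exp_neg_sq_div_two x).mul
        (isHermiteLadder_hermiteV.hasDerivAt n x)).const_mul ((-1 : ℝ) ^ n)).deriv.trans ?_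
      ring
  rw [hermiteH, key]
  have h1 : ((-1 : ℝ) ^ n) * (-1) ^ n = 1 := by rw [← mul_pow]; simp
  have h2 : exp (-x ^ 2 / 2) * exp (x ^ 2) * exp (-x ^ 2 / 2) = 1 := by
    rw [← exp_add, ← exp_add, ← exp_zero]
    congr 1
    ring
  linear_combination (hermiteV n x * exp (-x ^ 2 / 2) * exp (x ^ 2) * exp (-x ^ 2 / 2)) * h1 +
    hermiteV n x * h2

/-- The normalizing constant of the `n`-th Hermite function. -/
noncomputable def hermiteNorm (n : ℕ) : ℝ := (√(√π * 2 ^ n * (n.factorial : ℝ)))⁻¹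

theorem hermiteFun_eq (n : ℕ) (x : ℝ) : hermiteFun n x = hermiteNorm n * hermiteV n x := by
  rw [hermiteFun, ← hermiteH_mul_exp, hermiteNorm, mul_assoc]

theorem hermiteNorm_pos (n : ℕ) : 0 < hermiteNorm n := by
  have := n.factorial_pos
  unfold hermiteNorm
  positivity

theorem hermiteNorm_sq (n : ℕ) : hermiteNorm n ^ 2 = (√π * 2 ^ n * (n.factorial : ℝ))⁻¹ := by
  rw [hermiteNorm, inv_pow, sq_sqrt (by positivity)]

theorem hermiteNorm_sq_succ (n : ℕ) :
    2 * (n + 1) * hermiteNorm (n + 1) ^ 2 = hermiteNorm n ^ 2 := by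
  have := n.factorial_pos
  rw [hermiteNorm_sq, hermiteNorm_sq, Nat.factorial_succ]
  push_cast
  field_simp
  ring

/-! ### Energy bounds and comparison with trigonometric functions. -/

/-- Energy bound for solutions of `y'' = (x² - m) y`. -/
theorem sq_mul_le_energy {y z : ℝ → ℝ} {m : ℝ} (hy : ∀ x, HasDerivAt y (z x) x)
    (hz : ∀ x, HasDerivAt z ((x ^ 2 - m) * y x) x) {x : ℝ} (hx : 0 ≤ x) :
    (m - x ^ 2) * y x ^ 2 ≤ z 0 ^ 2 + m * y 0 ^ 2 := by
  -- The energy y'² + (m - t²) y² decreases for t ≥ 0, because only the potential depends on t.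
  have hE (t : ℝ) : HasDerivAt (fun t => z t ^ 2 + (m - t ^ 2) * y t ^ 2) (-2 * t * y t ^ 2) t := by
    refine (((hz t).pow 2).add ((((hasDerivAt_id t).pow 2).const_sub m).mul
      ((hy t).pow 2))).congr_deriv ?_
    simp only [id, Pi.pow_apply]
    push_cast
    ring
  have hanti : AntitoneOn (fun t => z t ^ 2 + (m - t ^ 2) * y t ^ 2) (Set.Ici 0) := by
    refine antitoneOn_of_deriv_nonpos (convex_Ici 0)
      (fun t _ => (hE t).continuousAt.continuousWithinAt)
      (fun t _ => (hE t).differentiableAt.differentiableWithinAt) fun t ht => ?_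
    rw [interior_Ici] at ht
    rw [(hE t).deriv]
    have := mul_nonneg (le_of_lt ht) (sq_nonneg (y t))
    linarith
  have h := hanti (Set.mem_Ici.2 le_rfl) hx hx
  simp only at h
  nlinarith [sq_nonneg (z x)]

/-- A solution of `y'' = (x² - 1 - w²) y` which is bounded by `M` on `[0, b]` is close to the
solution of `y'' = -w² y` with the same initial data. -/
theorem abs_sub_trig_le {y z : ℝ → ℝ} {w M b : ℝ} (hw : 0 < w) (hb : 0 ≤ b)
    (hy : ∀ x, HasDerivAt y (z x) x)
    (hz : ∀ x, HasDerivAt z ((x ^ 2 - (w ^ 2 + 1)) * y x) x)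
    (hM : ∀ x ∈ Set.Icc 0 b, |y x| ≤ M) :
    |y b - (y 0 * cos (w * b) + z 0 / w * sin (w * b))| ≤ 2 * ((b ^ 2 + 1) * M / w * b) := by
  have hs (x : ℝ) : HasDerivAt (fun x => sin (w * x)) (w * cos (w * x)) x := by
    refine ((hasDerivAt_id x).const_mul w).sin.congr_deriv ?_
    simp [mul_comm]
  have hc (x : ℝ) : HasDerivAt (fun x => cos (w * x)) (-(w * sin (w * x))) x := by
    refine ((hasDerivAt_id x).const_mul w).cos.congr_deriv ?_
    simp [mul_comm]
  -- Variation of parameters: rotating (y, y'/w) by the angle w x gives coordinates that are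
  -- constant for y'' = -w² y, so their derivatives contain only the perturbation (x² - 1) y / w.
  have hα (x : ℝ) : HasDerivAt (fun x => y x * cos (w * x) - z x / w * sin (w * x))
      (-((x ^ 2 - 1) * y x / w * sin (w * x))) x := by
    refine (((hy x).mul (hc x)).sub (((hz x).div_const w).mul (hs x))).congr_deriv ?_
    field_simp
    ring
  have hβ (x : ℝ) : HasDerivAt (fun x => y x * sin (w * x) + z x / w * cos (w * x))
      ((x ^ 2 - 1) * y x / w * cos (w * x)) x := by
    refine (((hy x).mul (hs x)).add (((hz x).div_const w).mul (hc x))).congr_deriv ?_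
    field_simp
    ring
  have hbd : ∀ x ∈ Set.Icc 0 b, |(x ^ 2 - 1) * y x / w| ≤ (b ^ 2 + 1) * M / w := by
    intro x hx
    rw [abs_div, abs_mul, abs_of_pos hw]
    have h1 : |x ^ 2 - 1| ≤ b ^ 2 + 1 := by
      have : x ^ 2 ≤ b ^ 2 := pow_le_pow_left₀ hx.1 hx.2 2
      rw [abs_le]
      constructor <;> nlinarith [sq_nonneg x]
    have h2 := hM x hx
    gcongr
  have hbd' {t : ℝ} (ht : |t| ≤ 1) : ∀ x ∈ Set.Icc 0 b,
      |(x ^ 2 - 1) * y x / w * t| ≤ (b ^ 2 + 1) * M / w := by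
    intro x hx
    rw [abs_mul]
    exact (mul_le_of_le_one_right (abs_nonneg _) ht).trans (hbd x hx)
  have eα := (convex_Icc 0 b).norm_image_sub_le_of_norm_hasDerivWithin_le
    (C := (b ^ 2 + 1) * M / w) (fun x _ => (hα x).hasDerivWithinAt)
    (fun x hx => by rw [norm_neg]; exact hbd' (abs_sin_le_one _) x hx)
    (Set.left_mem_Icc.2 hb) (Set.right_mem_Icc.2 hb)
  have eβ := (convex_Icc 0 b).norm_image_sub_le_of_norm_hasDerivWithin_le
    (C := (b ^ 2 + 1) * M / w) (fun x _ => (hβ x).hasDerivWithinAt)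
    (fun x hx => hbd' (abs_cos_le_one _) x hx)
    (Set.left_mem_Icc.2 hb) (Set.right_mem_Icc.2 hb)
  simp only [norm_eq_abs, mul_zero, cos_zero, sin_zero, mul_one, sub_zero, zero_add,
    abs_of_nonneg hb] at eα eβ
  have hsc := sin_sq_add_cos_sq (w * b)
  have key : y b - (y 0 * cos (w * b) + z 0 / w * sin (w * b)) =
      (y b * cos (w * b) - z b / w * sin (w * b) - y 0) * cos (w * b) +
      (y b * sin (w * b) + z b / w * cos (w * b) - z 0 / w) * sin (w * b) := by
    linear_combination (-(y b)) * hsc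
  rw [key]
  refine (abs_add_le _ _).trans ?_
  rw [abs_mul, abs_mul, two_mul]
  exact add_le_add ((mul_le_of_le_one_right (abs_nonneg _) (abs_cos_le_one _)).trans eα)
    ((mul_le_of_le_one_right (abs_nonneg _) (abs_sin_le_one _)).trans eβ)

namespace IsHermiteLadder

variable {f : ℕ → ℝ → ℝ}

theorem sq_mul_le (hf : IsHermiteLadder f) (n : ℕ) {x : ℝ} (hx : 0 ≤ x) :
    (2 * n + 1 - x ^ 2) * f n x ^ 2 ≤ f (n + 1) 0 ^ 2 + (2 * n + 1) * f n 0 ^ 2 := by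
  have := sq_mul_le_energy (hf.hasDerivAt n) (hf.hasDerivAt_deriv n) hx
  simpa using this

theorem abs_sub_trig_le (hf : IsHermiteLadder f) {n : ℕ} (hn : 0 < n) {M b : ℝ} (hb : 0 ≤ b)
    (hM : ∀ x ∈ Set.Icc 0 b, |f n x| ≤ M) :
    |f n b - (f n 0 * cos (√(2 * n) * b) - f (n + 1) 0 / √(2 * n) * sin (√(2 * n) * b))| ≤
      2 * ((b ^ 2 + 1) * M / √(2 * n) * b) := by
  have hw : √(2 * (n : ℝ)) ^ 2 = 2 * n := sq_sqrt (by positivity)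
  have := _root_.abs_sub_trig_le (w := √(2 * n)) (by positivity) hb (hf.hasDerivAt n)
    (fun x => by rw [hw]; exact hf.hasDerivAt_deriv n x) hM
  convert this using 3
  ring

/-- A priori bound for the solution with zero slope at 0; x² ≤ n keeps 2n + 1 - x² at least n + 1.
-/
theorem abs_le_of_deriv_eq_zero (hf : IsHermiteLadder f) {n : ℕ} {b : ℝ} (hbn : b ^ 2 ≤ n)
    (h0 : f (n + 1) 0 = 0) : ∀ x ∈ Set.Icc 0 b, |f n x| ≤ √2 * |f n 0| := by
  intro x hx
  have h1 := hf.sq_mul_le n hx.1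
  have h2 : x ^ 2 ≤ n := (pow_le_pow_left₀ hx.1 hx.2 2).trans hbn
  refine abs_le_of_sq_le_sq ?_ (by positivity)
  rw [mul_pow, sq_sqrt (by norm_num), sq_abs]
  rw [h0] at h1
  have hn : (0 : ℝ) ≤ n := n.cast_nonneg
  have h3 : ((n : ℝ) + 1) * f n x ^ 2 ≤ (2 * n + 1 - x ^ 2) * f n x ^ 2 := by
    gcongr
    linarith
  have h4 : ((n : ℝ) + 1) * f n x ^ 2 ≤ ((n : ℝ) + 1) * (2 * f n 0 ^ 2) := by
    nlinarith [sq_nonneg (f n 0)]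
  exact le_of_mul_le_mul_left h4 (by positivity)

theorem abs_le_of_eq_zero (hf : IsHermiteLadder f) {n : ℕ} (hn : 0 < n) {b : ℝ} (hbn : b ^ 2 ≤ n)
    (h0 : f n 0 = 0) : ∀ x ∈ Set.Icc 0 b, |f n x| ≤ √2 / √(2 * n) * |f (n + 1) 0| := by
  intro x hx
  have h1 := hf.sq_mul_le n hx.1
  have h2 : x ^ 2 ≤ n := (pow_le_pow_left₀ hx.1 hx.2 2).trans hbn
  have hn : (0 : ℝ) < n := by exact_mod_cast hn
  refine abs_le_of_sq_le_sq ?_ (by positivity)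
  rw [mul_pow, div_pow, sq_sqrt (by norm_num), sq_abs, sq_sqrt (by positivity)]
  rw [h0] at h1
  have h3 : (n : ℝ) * f n x ^ 2 ≤ (2 * n + 1 - x ^ 2) * f n x ^ 2 := by
    gcongr
    linarith
  have h4 : (n : ℝ) * f n x ^ 2 ≤ f (n + 1) 0 ^ 2 := by
    nlinarith
  rw [show 2 / (2 * (n : ℝ)) = 1 / n by field_simp, one_div, inv_mul_eq_div, le_div_iff₀ hn]
  linarith

variable {g : ℕ → ℝ → ℝ}

/-- The product of an even and an odd solution of the same Hermite equation. -/
theorem abs_mul_sub_sin_le (hf : IsHermiteLadder f) (hg : IsHermiteLadder g) {n : ℕ} (hn : 0 < n)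
    {b : ℝ} (hb : 0 ≤ b) (hbn : b ^ 2 ≤ n) (hf0 : f (n + 1) 0 = 0) (hg0 : g n 0 = 0) :
    |f n b * g n b + f n 0 * g (n + 1) 0 * (sin (2 * b * √(2 * n)) / (2 * √(2 * n)))| ≤
      |f n 0 * g (n + 1) 0| * (5 * (b ^ 2 + 1) * b / n) := by
  have hn' : (0 : ℝ) < n := by exact_mod_cast hn
  have hMf := hf.abs_le_of_deriv_eq_zero hbn hf0
  have hMg := hg.abs_le_of_eq_zero hn hbn hg0
  have ef := hf.abs_sub_trig_le hn hb hMf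
  have eg := hg.abs_sub_trig_le hn hb hMg
  have hgb := hMg b (Set.right_mem_Icc.2 hb)
  have hw : √(2 * (n : ℝ)) ^ 2 = 2 * n := sq_sqrt (by positivity)
  have hw0 : 0 < √(2 * (n : ℝ)) := by positivity
  have hsin : sin (2 * b * √(2 * n)) = 2 * sin (√(2 * n) * b) * cos (√(2 * n) * b) := by
    rw [← sin_two_mul]
    congr 1
    ring
  rw [hsin]
  rw [hf0, zero_div, zero_mul, sub_zero] at ef
  rw [hg0, zero_mul, zero_sub] at eg
  generalize √(2 * (n : ℝ)) = w at *
  have key : f n b * g n b + f n 0 * g (n + 1) 0 *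
      (2 * sin (w * b) * cos (w * b) / (2 * w)) =
      (f n b - f n 0 * cos (w * b)) * g n b +
      f n 0 * cos (w * b) * (g n b - -(g (n + 1) 0 / w * sin (w * b))) := by
    field_simp
    ring
  rw [key]
  refine (abs_add_le _ _).trans ?_
  rw [abs_mul, abs_mul, abs_mul, abs_mul]
  -- The two error terms add up to (4 + 2√2)/w² = (2 + √2)/n, whence the constant 5.
  have h2 : √(2 : ℝ) ^ 2 = 2 := sq_sqrt (by norm_num)
  have h32 : √(2 : ℝ) ≤ 3 / 2 := by
    rw [sqrt_le_left (by norm_num)]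
    norm_num
  calc _ ≤ 2 * ((b ^ 2 + 1) * (√2 * |f n 0|) / w * b) * (√2 / w * |g (n + 1) 0|) +
        |f n 0| * 1 * (2 * ((b ^ 2 + 1) * (√2 / w * |g (n + 1) 0|) / w * b)) := by
        gcongr
        exact abs_cos_le_one _
    _ = |f n 0| * |g (n + 1) 0| * ((b ^ 2 + 1) * b) * (2 * √2 ^ 2 + 2 * √2) / w ^ 2 := by
        field_simp
    _ = |f n 0| * |g (n + 1) 0| * ((b ^ 2 + 1) * b) * (2 + √2) / n := by
        rw [hw, h2]
        field_simp
    _ ≤ |f n 0| * |g (n + 1) 0| * ((b ^ 2 + 1) * b) * 5 / n := by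
        gcongr
        linarith
    _ = _ := by ring

end IsHermiteLadder

/-- The closed form of the odd part of the diagonal of the resolvent, up to normalization,
is asymptotic to a sine. -/
theorem abs_hermiteU_mul_hermiteV_sub_le {n : ℕ} (hn : 0 < n) {b : ℝ} (hb : 0 ≤ b)
    (hbn : b ^ 2 ≤ n) :
    |hermiteU n b * hermiteV n b / -(2 ^ n * n.factorial) -
      (-1) ^ (n + 1) * sin (2 * b * √(2 * n)) / (2 * √(2 * n))| ≤ 5 * (b ^ 2 + 1) * b / n := by
  have hW := hermiteU_hermiteV_wronskian n 0
  have hWpos : (0 : ℝ) < 2 ^ n * n.factorial := by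
    have := n.factorial_pos
    positivity
  set W : ℝ := 2 ^ n * n.factorial
  set S := sin (2 * b * √(2 * n)) / (2 * √(2 * n)) with hS
  have hU := isHermiteLadder_hermiteU
  have hV := isHermiteLadder_hermiteV
  have hU0 := hermiteU_neg n 0
  have hU1 := hermiteU_neg (n + 1) 0
  have hV0 := hermiteV_neg n 0
  have hV1 := hermiteV_neg (n + 1) 0
  simp only [neg_zero, pow_succ] at hU0 hU1 hV0 hV1
  rw [mul_div_assoc _ (sin _), ← hS]
  have hfin {A B : ℝ} (h : |A| ≤ W * B) : |A / W| ≤ B := by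
    rw [abs_div, abs_of_pos hWpos, div_le_iff₀ hWpos]
    linarith
  -- At 0 the odd one of U_n, V_n vanishes and so does the derivative of the even one. One term of
  -- the Wronskian survives, and its sign produces the factor (-1)^(n+1).
  rcases Nat.even_or_odd n with he | ho
  · have hp : (-1 : ℝ) ^ n = 1 := he.neg_one_pow
    rw [hp] at hU0 hU1 hV0 hV1
    have z1 : hermiteU n 0 = 0 := by linarith
    have z2 : hermiteV (n + 1) 0 = 0 := by linarith
    have h := hV.abs_mul_sub_sin_le hU hn hb hbn z2 z1
    rw [z1, z2] at hW
    have hp : hermiteV n 0 * hermiteU (n + 1) 0 = -W := by linarith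
    rw [hp, abs_neg, abs_of_pos hWpos, ← hS] at h
    rw [pow_succ, he.neg_one_pow]
    have : hermiteU n b * hermiteV n b / -W - 1 * -1 * S =
        -((hermiteV n b * hermiteU n b + -W * S) / W) := by
      field_simp
      ring
    rw [this, abs_neg]
    exact hfin h
  · have hp : (-1 : ℝ) ^ n = -1 := ho.neg_one_pow
    rw [hp] at hU0 hU1 hV0 hV1
    have z1 : hermiteV n 0 = 0 := by linarith
    have z2 : hermiteU (n + 1) 0 = 0 := by linarith
    have h := hU.abs_mul_sub_sin_le hV hn hb hbn z2 z1
    rw [z1, z2] at hW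
    have hp : hermiteU n 0 * hermiteV (n + 1) 0 = W := by linarith
    rw [hp, abs_of_pos hWpos, ← hS] at h
    rw [pow_succ, ho.neg_one_pow]
    have : hermiteU n b * hermiteV n b / -W - -1 * -1 * S =
        -((hermiteU n b * hermiteV n b + W * S) / W) := by
      field_simp
      ring
    rw [this, abs_neg]
    exact hfin h

/-! ### Size of the normalized Hermite functions. -/

/-- Bound for the normalized Hermite functions at the origin. -/
theorem hermiteFun_zero_pow_four_le (n : ℕ) : (n + 1) * (hermiteFun n 0 ^ 2) ^ 2 ≤ 1 := by
  induction n using Nat.twoStepInduction with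
  | zero =>
    rw [hermiteFun_eq, mul_pow, hermiteNorm_sq, hermiteV_zero]
    simp only [pow_zero, Nat.factorial_zero, Nat.cast_zero, Nat.cast_one, mul_one, zero_add, one_mul]
    norm_num
    rw [sq_sqrt pi_pos.le]
    exact inv_le_one_of_one_le₀ (by linarith [pi_gt_three])
  | one => simp [hermiteFun_eq, hermiteV_one]
  | more n ih _ =>
    have h1 := hermiteNorm_sq_succ n
    have h2 := hermiteNorm_sq_succ (n + 1)
    -- At 0 the recurrence has two terms only; the induction then closes by (n + 1)(n + 3) ≤ (n +
    -- 2)².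
    have hq : (n + 2) * hermiteFun (n + 2) 0 ^ 2 = (n + 1) * hermiteFun n 0 ^ 2 := by
      rw [hermiteFun_eq, hermiteFun_eq, isHermiteLadder_hermiteV.recurrence]
      push_cast at h2
      rw [show n + 1 + 1 = n + 2 by ring] at h2
      have h3 : 4 * ((n : ℝ) + 1) * (n + 2) * hermiteNorm (n + 2) ^ 2 = hermiteNorm n ^ 2 := by
        linear_combination h1 + 2 * ((n : ℝ) + 1) * h2
      simp only [mul_zero, zero_mul, zero_sub]
      linear_combination ((n : ℝ) + 1) * hermiteV n 0 ^ 2 * h3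
    set p := hermiteFun (n + 2) 0 ^ 2
    set q := hermiteFun n 0 ^ 2
    have hp : p = (n + 1) * q / (n + 2) := by
      rw [← hq]
      field_simp
    have hn : (0 : ℝ) ≤ n := n.cast_nonneg
    rw [hp]
    push_cast
    calc ((n : ℝ) + 2 + 1) * ((n + 1) * q / (n + 2)) ^ 2
        = ((n + 3) * (n + 1)) / (n + 2) ^ 2 * ((n + 1) * q ^ 2) := by
          field_simp
          ring
      _ ≤ 1 * 1 := by
          gcongr
          rw [div_le_one (by positivity)]
          nlinarith
      _ = 1 := by ring

theorem hermiteFun_zero_sq_le (n : ℕ) : hermiteFun n 0 ^ 2 ≤ 1 / √(n + 1) := by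
  refine abs_le_of_sq_le_sq' ?_ (by positivity) |>.2
  rw [div_pow, sq_sqrt (by positivity), one_pow, le_div_iff₀ (by positivity)]
  linarith [hermiteFun_zero_pow_four_le n]

/-- The energy bound carries the estimate from the origin to x. The decay k^{-1/2} of h_k² is what
makes the series for σ̃ converge absolutely. -/
theorem hermiteFun_sq_le {n : ℕ} {x : ℝ} (hx : 0 ≤ x) (hxn : x ^ 2 ≤ n) :
    hermiteFun n x ^ 2 ≤ 4 / √(n + 1) := by
  have h := isHermiteLadder_hermiteV.sq_mul_le n hx
  have hN := hermiteNorm_sq_succ n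
  have h0 := hermiteFun_zero_sq_le n
  have h1 := hermiteFun_zero_sq_le (n + 1)
  have hs : √((n : ℝ) + 1) ^ 2 = n + 1 := sq_sqrt (by positivity)
  have h1' : hermiteFun (n + 1) 0 ^ 2 ≤ 1 / √(n + 1) := by
    refine h1.trans ?_
    push_cast
    gcongr
    linarith
  have hE : (2 * n + 1 - x ^ 2) * hermiteFun n x ^ 2 ≤
      2 * (n + 1) * hermiteFun (n + 1) 0 ^ 2 + (2 * n + 1) * hermiteFun n 0 ^ 2 := by
    simp only [hermiteFun_eq, mul_pow]
    have := mul_le_mul_of_nonneg_left h (sq_nonneg (hermiteNorm n))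
    nlinarith
  have h3 : ((n : ℝ) + 1) * hermiteFun n x ^ 2 ≤ (2 * n + 1 - x ^ 2) * hermiteFun n x ^ 2 := by
    gcongr
    linarith
  have h4 : ((n : ℝ) + 1) * hermiteFun n x ^ 2 ≤ (n + 1) * (4 / √(n + 1)) := by
    calc _ ≤ _ := h3.trans hE
      _ ≤ 2 * (n + 1) * (1 / √(n + 1)) + (2 * n + 2) * (1 / √(n + 1)) := by
        gcongr
        linarith
      _ = _ := by ring
  exact le_of_mul_le_mul_left h4 (by positivity)

/-! ### Gaussian decay and orthonormality. -/

section HermiteExpansion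

open MeasureTheory Filter Topology

/-- Domination by a Gaussian. -/
def HasGaussianDecay (f : ℝ → ℝ) : Prop :=
  ∃ C, ∀ x, |f x| ≤ C * exp (-(1 / 4) * x ^ 2)

namespace HasGaussianDecay

variable {f g : ℝ → ℝ}

theorem add (hf : HasGaussianDecay f) (hg : HasGaussianDecay g) :
    HasGaussianDecay (fun x => f x + g x) := by
  obtain ⟨C, hC⟩ := hf
  obtain ⟨D, hD⟩ := hg
  exact ⟨C + D, fun x => (abs_add_le _ _).trans (by linarith [hC x, hD x])⟩

theorem const_mul (hf : HasGaussianDecay f) (c : ℝ) : HasGaussianDecay (fun x => c * f x) := by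
  obtain ⟨C, hC⟩ := hf
  refine ⟨|c| * C, fun x => ?_⟩
  rw [abs_mul, mul_assoc]
  exact mul_le_mul_of_nonneg_left (hC x) (abs_nonneg c)

theorem sub (hf : HasGaussianDecay f) (hg : HasGaussianDecay g) :
    HasGaussianDecay (fun x => f x - g x) := by
  simpa [sub_eq_add_neg] using hf.add (hg.const_mul (-1))

theorem mul (hf : HasGaussianDecay f) (hg : HasGaussianDecay g) :
    HasGaussianDecay (fun x => f x * g x) := by
  obtain ⟨C, hC⟩ := hf
  obtain ⟨D, hD⟩ := hg
  refine ⟨C * D, fun x => ?_⟩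
  have h0 := (abs_nonneg _).trans (hC 0)
  have h0' := (abs_nonneg _).trans (hD 0)
  simp only [ne_eq, OfNat.ofNat_ne_zero, not_false_eq_true, zero_pow, mul_zero, exp_zero,
    mul_one] at h0 h0'
  have he : exp (-(1 / 4) * x ^ 2) ≤ 1 := exp_le_one_iff.2 (by nlinarith [sq_nonneg x])
  calc |f x * g x| = |f x| * |g x| := abs_mul _ _
    _ ≤ (C * exp (-(1 / 4) * x ^ 2)) * (D * 1) := by
        gcongr
        · exact hC x
        · exact (hD x).trans (by gcongr)
    _ = _ := by ring

theorem integrable (hf : HasGaussianDecay f) (hc : Continuous f) : Integrable f := by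
  obtain ⟨C, hC⟩ := hf
  exact ((integrable_exp_neg_mul_sq (b := 1 / 4) (by norm_num)).const_mul C).mono'
    hc.aestronglyMeasurable (.of_forall hC)

theorem memLp_two (hf : HasGaussianDecay f) (hc : Continuous f) : MemLp f 2 := by
  rw [memLp_two_iff_integrable_sq hc.aestronglyMeasurable]
  simp only [sq]
  exact (hf.mul hf).integrable (hc.mul hc)

theorem tendsto_cocompact (hf : HasGaussianDecay f) : Tendsto f (cocompact ℝ) (𝓝 0) := by
  obtain ⟨C, hC⟩ := hf
  refine squeeze_zero_norm hC ?_
  rw [← mul_zero C]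
  refine Tendsto.const_mul C (tendsto_exp_atBot.comp ?_)
  have h : Tendsto (fun x : ℝ => ‖x‖ ^ 2) (cocompact ℝ) atTop :=
    (tendsto_pow_atTop two_ne_zero).comp (tendsto_norm_cocompact_atTop (E := ℝ))
  simp only [norm_eq_abs, sq_abs] at h
  exact h.const_mul_atTop_of_neg (by norm_num)

theorem tendsto_atTop (hf : HasGaussianDecay f) : Tendsto f atTop (𝓝 0) :=
  hf.tendsto_cocompact.mono_left atTop_le_cocompact

theorem tendsto_atBot (hf : HasGaussianDecay f) : Tendsto f atBot (𝓝 0) :=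
  hf.tendsto_cocompact.mono_left atBot_le_cocompact

end HasGaussianDecay

/-- Half of the exponent x²/2 is spent on absorbing powers of x, through |x|^m ≤ m! e^{|x|} and |x|
≤ 1 + x²/4. -/
theorem hasGaussianDecay_pow_mul_hermiteV (n m : ℕ) :
    HasGaussianDecay (fun x => x ^ m * hermiteV n x) := by
  have h0 (m : ℕ) : HasGaussianDecay (fun x => x ^ m * exp (-x ^ 2 / 2)) := by
    refine ⟨m.factorial * exp 1, fun x => ?_⟩
    have h1 := pow_div_factorial_le_exp |x| (abs_nonneg x) m
    rw [div_le_iff₀ (by exact_mod_cast m.factorial_pos)] at h1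
    have h2 : |x| ≤ 1 + x ^ 2 / 4 := by
      rw [← sq_abs x]
      nlinarith [sq_nonneg (|x| / 2 - 1)]
    rw [abs_mul, abs_pow, abs_exp, mul_assoc, ← exp_add]
    calc |x| ^ m * exp (-x ^ 2 / 2) ≤ (exp |x| * m.factorial) * exp (-x ^ 2 / 2) := by gcongr
      _ = m.factorial * exp (|x| + -x ^ 2 / 2) := by rw [exp_add]; ring
      _ ≤ _ := mul_le_mul_of_nonneg_left (exp_le_exp.2 (by linarith)) (by positivity)
  induction n using Nat.twoStepInduction generalizing m with
  | zero => simpa only [hermiteV_zero] using h0 m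
  | one =>
    simp only [hermiteV_one]
    convert (h0 (m + 1)).const_mul 2 using 2 with x
    ring
  | more n ih₀ ih₁ =>
    simp only [isHermiteLadder_hermiteV.recurrence]
    convert ((ih₁ (m + 1)).const_mul 2).sub ((ih₀ m).const_mul (2 * (n + 1))) using 2 with x
    ring

theorem hasGaussianDecay_hermiteV (n : ℕ) : HasGaussianDecay (hermiteV n) := by
  simpa using hasGaussianDecay_pow_mul_hermiteV n 0

theorem continuous_hermiteV (n : ℕ) : Continuous (hermiteV n) :=
  isHermiteLadder_hermiteV.continuous n

theorem memLp_hermiteV (n : ℕ) : MemLp (hermiteV n) 2 :=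
  (hasGaussianDecay_hermiteV n).memLp_two (continuous_hermiteV n)

theorem integrable_hermiteV_mul (n k : ℕ) : Integrable (fun x => hermiteV n x * hermiteV k x) :=
  ((hasGaussianDecay_hermiteV n).mul (hasGaussianDecay_hermiteV k)).integrable
    ((continuous_hermiteV n).mul (continuous_hermiteV k))

theorem hasGaussianDecay_deriv_hermiteV (n : ℕ) :
    HasGaussianDecay (fun x => x * hermiteV n x - hermiteV (n + 1) x) := by
  simpa using (hasGaussianDecay_pow_mul_hermiteV n 1).sub (hasGaussianDecay_hermiteV (n + 1))

theorem hasGaussianDecay_wronskian_hermiteV (n k : ℕ) :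
    HasGaussianDecay (fun y => hermiteV n y * (y * hermiteV k y - hermiteV (k + 1) y) -
      (y * hermiteV n y - hermiteV (n + 1) y) * hermiteV k y) :=
  ((hasGaussianDecay_hermiteV n).mul (hasGaussianDecay_deriv_hermiteV k)).sub
    ((hasGaussianDecay_deriv_hermiteV n).mul (hasGaussianDecay_hermiteV k))

/-- The product is, up to the factor 2(n - k), the derivative of a Wronskian that vanishes at ±∞. -/
theorem integral_hermiteV_mul_of_ne {n k : ℕ} (hnk : n ≠ k) :
    ∫ x, hermiteV n x * hermiteV k x = 0 := by
  have h := integral_of_hasDerivAt_of_tendsto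
    (isHermiteLadder_hermiteV.hasDerivAt_wronskian isHermiteLadder_hermiteV n k)
    ((integrable_hermiteV_mul n k).const_mul _)
    (hasGaussianDecay_wronskian_hermiteV n k).tendsto_atBot
    (hasGaussianDecay_wronskian_hermiteV n k).tendsto_atTop
  rw [integral_const_mul, sub_zero] at h
  refine (mul_eq_zero.1 h).resolve_left ?_
  have : (n : ℝ) - k ≠ 0 := sub_ne_zero.2 (by exact_mod_cast hnk)
  positivity

theorem integral_hermiteV_sq (n : ℕ) :
    ∫ x, hermiteV n x * hermiteV n x = √π * 2 ^ n * n.factorial := by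
  induction n with
  | zero =>
    simp only [hermiteV_zero, ← exp_add]
    have := integral_gaussian 1
    simp only [div_one] at this
    simp only [pow_zero, mul_one, Nat.factorial_zero, Nat.cast_one]
    rw [← this]
    congr 1
    ext x
    congr 1
    ring
  | succ n ih =>
    -- Integrating this total derivative gives ‖V_{n+1}‖² = 2(n + 1) ‖V_n‖².
    have hd (x : ℝ) : HasDerivAt (fun x => hermiteV n x * hermiteV (n + 1) x)
        (2 * (n + 1) * (hermiteV n x * hermiteV n x) -
          hermiteV (n + 1) x * hermiteV (n + 1) x) x := by
      refine ((isHermiteLadder_hermiteV.hasDerivAt n x).mul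
        (isHermiteLadder_hermiteV.hasDerivAt (n + 1) x)).congr_deriv ?_
      rw [show n + 1 + 1 = n + 2 by ring, isHermiteLadder_hermiteV.recurrence]
      ring
    have hi := integrable_hermiteV_mul n n
    have hi' := integrable_hermiteV_mul (n + 1) (n + 1)
    have hdec := (hasGaussianDecay_hermiteV n).mul (hasGaussianDecay_hermiteV (n + 1))
    have h := integral_of_hasDerivAt_of_tendsto hd ((hi.const_mul _).sub hi')
      hdec.tendsto_atBot hdec.tendsto_atTop
    rw [integral_sub (hi.const_mul _) hi', integral_const_mul, ih] at h
    rw [Nat.factorial_succ, pow_succ]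
    push_cast
    linarith

theorem continuous_hermiteFun (n : ℕ) : Continuous (hermiteFun n) := by
  simp only [funext (hermiteFun_eq n)]
  exact (continuous_hermiteV n).const_mul _

theorem memLp_hermiteFun (n : ℕ) : MemLp (hermiteFun n) 2 := by
  simp only [funext (hermiteFun_eq n)]
  exact (memLp_hermiteV n).const_mul _

theorem integral_hermiteFun_mul (n k : ℕ) :
    ∫ x, hermiteFun n x * hermiteFun k x = if n = k then 1 else 0 := by
  have : ∀ x, hermiteFun n x * hermiteFun k x =
      hermiteNorm n * hermiteNorm k * (hermiteV n x * hermiteV k x) := fun x => by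
    rw [hermiteFun_eq, hermiteFun_eq]
    ring
  simp only [this]
  rw [integral_const_mul]
  split_ifs with h
  · subst h
    have := n.factorial_pos
    rw [integral_hermiteV_sq, ← sq, hermiteNorm_sq, inv_mul_cancel₀ (by positivity)]
  · rw [integral_hermiteV_mul_of_ne h, mul_zero]

/-! ### Completeness and the Parseval identity. -/

/-- An integrable function with vanishing Fourier transform vanishes almost everywhere. -/
theorem ae_eq_zero_of_forall_integral_mul_cexp_eq_zero {φ : ℝ → ℝ} (hφ : Integrable φ)
    (h : ∀ t : ℝ, ∫ x, (φ x : ℂ) * Complex.exp (t * x * Complex.I) = 0) : φ =ᵐ[volume] 0 := by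
  have hm : AEMeasurable φ := hφ.aestronglyMeasurable.aemeasurable
  have hm' : AEMeasurable (fun x => -φ x) := hm.neg
  have : IsFiniteMeasure (volume.withDensity fun x => ENNReal.ofReal (φ x)) :=
    isFiniteMeasure_withDensity_ofReal hφ.2
  have : IsFiniteMeasure (volume.withDensity fun x => ENNReal.ofReal (-φ x)) :=
    isFiniteMeasure_withDensity_ofReal hφ.neg.2
  have hexp (ψ : ℝ → ℝ) (hψ : Integrable ψ) (t : ℝ) :
      Integrable fun x => ψ x • Complex.exp (t * x * Complex.I) := by
    refine hψ.norm.mono' (hψ.aestronglyMeasurable.smul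
      (by fun_prop : Continuous fun x : ℝ =>
        Complex.exp (t * x * Complex.I)).aestronglyMeasurable) (.of_forall fun x => ?_)
    rw [norm_smul, ← Complex.ofReal_mul, Complex.norm_exp_ofReal_mul_I, mul_one]
  -- The positive and negative parts of φ are densities of finite measures with the same
  -- characteristic function.
  have heq : (volume.withDensity fun x => ENNReal.ofReal (φ x)) =
      volume.withDensity fun x => ENNReal.ofReal (-φ x) := by
    refine Measure.ext_of_charFun (funext fun t => ?_)
    rw [charFun_apply_real, charFun_apply_real,
      integral_withDensity_eq_integral_toReal_smul₀ hm.ennreal_ofReal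
        (.of_forall fun x => ENNReal.ofReal_lt_top),
      integral_withDensity_eq_integral_toReal_smul₀ hm'.ennreal_ofReal
        (.of_forall fun x => ENNReal.ofReal_lt_top), ← sub_eq_zero]
    simp only [ENNReal.toReal_ofReal']
    rw [← integral_sub (hexp _ hφ.pos_part t) (hexp _ hφ.neg_part t), ← h t]
    refine integral_congr_ae (.of_forall fun x => ?_)
    simp only
    rw [← sub_smul, max_zero_sub_max_neg_zero_eq_self, Complex.real_smul]
  rw [withDensity_eq_iff hm.ennreal_ofReal hm'.ennreal_ofReal
    (ne_of_lt hφ.lintegral_lt_top)] at heq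
  filter_upwards [heq] with x hx
  have h1 := congrArg ENNReal.toReal hx
  rw [ENNReal.toReal_ofReal', ENNReal.toReal_ofReal'] at h1
  have h2 := max_zero_sub_max_neg_zero_eq_self (φ x)
  simp only [Pi.zero_apply]
  linarith

/-- The Hermite functions are complete in `L²(ℝ)`. -/
theorem ae_eq_zero_of_forall_integral_mul_hermiteV_eq_zero {f : ℝ → ℝ} (hf : MemLp f 2)
    (h : ∀ k, ∫ x, f x * hermiteV k x = 0) : f =ᵐ[volume] 0 := by
  have hint (m k : ℕ) : Integrable fun x => f x * (x ^ m * hermiteV k x) :=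
    hf.integrable_mul ((hasGaussianDecay_pow_mul_hermiteV k m).memLp_two
      ((continuous_pow m).mul (continuous_hermiteV k)))
  -- The recurrence trades a factor x for a shift of k, so all moments of f V_0 vanish; expanding
  -- the exponential then shows that its Fourier transform is zero.
  have hmom (m k : ℕ) : ∫ x, f x * (x ^ m * hermiteV k x) = 0 := by
    induction m generalizing k with
    | zero => simpa using h k
    | succ m ih =>
      cases k with
      | zero =>
        have : ∀ x, f x * (x ^ (m + 1) * hermiteV 0 x) =
            1 / 2 * (f x * (x ^ m * hermiteV 1 x)) := fun x => by
          rw [hermiteV_zero, hermiteV_one]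
          ring
        simp only [this]
        rw [integral_const_mul, ih, mul_zero]
      | succ k =>
        have : ∀ x, f x * (x ^ (m + 1) * hermiteV (k + 1) x) =
            1 / 2 * (f x * (x ^ m * hermiteV (k + 2) x)) +
              (k + 1) * (f x * (x ^ m * hermiteV k x)) := fun x => by
          rw [isHermiteLadder_hermiteV.recurrence]
          ring
        simp only [this]
        rw [integral_add ((hint _ _).const_mul _) ((hint _ _).const_mul _), integral_const_mul,
          integral_const_mul, ih, ih, mul_zero, mul_zero, add_zero]
  have hφ : Integrable fun x => f x * hermiteV 0 x := by simpa using hint 0 0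
  have hzero := ae_eq_zero_of_forall_integral_mul_cexp_eq_zero hφ fun t => by
    -- Domination for integrating the exponential series term by term: |t x| ≤ t² + x²/4.
    have hbd : HasGaussianDecay fun x => hermiteV 0 x * exp |t * x| := by
      refine ⟨exp (t ^ 2), fun x => ?_⟩
      simp only [hermiteV_zero]
      rw [← exp_add, ← exp_add, abs_exp, exp_le_exp, abs_mul, ← sq_abs t,
        ← sq_abs x]
      nlinarith [sq_nonneg (|t| - |x| / 2)]
    have hs := hasSum_integral_of_dominated_convergence (μ := volume)
      (F := fun (m : ℕ) x => ((f x * hermiteV 0 x : ℝ) : ℂ) *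
        ((t * x * Complex.I) ^ m / m.factorial))
      (f := fun x => ((f x * hermiteV 0 x : ℝ) : ℂ) * Complex.exp (t * x * Complex.I))
      (fun m x => |f x * hermiteV 0 x| * (|t * x| ^ m / m.factorial))
      (fun m => (Complex.continuous_ofReal.comp_aestronglyMeasurable
        hφ.aestronglyMeasurable).mul
        (by fun_prop : Continuous fun x : ℝ =>
          ((t * x * Complex.I) ^ m / m.factorial : ℂ)).aestronglyMeasurable)
      (fun m => .of_forall fun x => by
        simp [abs_mul])
      (.of_forall fun x => (summable_pow_div_factorial _).mul_left _)
      (by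
        have : ∀ x, ∑' m : ℕ, |f x * hermiteV 0 x| * (|t * x| ^ m / m.factorial) =
            |f x * (hermiteV 0 x * exp |t * x|)| := fun x => by
          rw [tsum_mul_left, ← mul_assoc, abs_mul _ (exp _), abs_exp, exp_eq_exp_ℝ,
            NormedSpace.exp_eq_tsum_div]
        simp only [this]
        exact (hf.integrable_mul (hbd.memLp_two ((continuous_hermiteV 0).mul
          (by fun_prop)))).abs)
      (.of_forall fun x => by
        have := NormedSpace.expSeries_div_hasSum_exp (t * x * Complex.I : ℂ)
        rw [← Complex.exp_eq_exp_ℂ] at this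
        exact this.mul_left _)
    have hterm (m : ℕ) : ∫ x, ((f x * hermiteV 0 x : ℝ) : ℂ) *
        ((t * x * Complex.I) ^ m / m.factorial) = 0 := by
      have : ∀ x : ℝ, ((f x * hermiteV 0 x : ℝ) : ℂ) * ((t * x * Complex.I) ^ m / m.factorial) =
          ((f x * (x ^ m * hermiteV 0 x) : ℝ) : ℂ) * ((t * Complex.I) ^ m / m.factorial) := by
        intro x
        push_cast
        ring
      simp only [this]
      rw [integral_mul_const, integral_complex_ofReal, hmom]
      simp
    simp only [hterm] at hs
    exact hs.unique hasSum_zero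
  filter_upwards [hzero] with x hx
  exact (mul_eq_zero.1 hx).resolve_right (by rw [hermiteV_zero]; exact (exp_pos _).ne')

/-- The Hermite functions as elements of `L²(ℝ)`. -/
noncomputable def hermiteLp (n : ℕ) : Lp ℝ 2 (volume : Measure ℝ) := (memLp_hermiteFun n).toLp

theorem inner_toLp_toLp {f g : ℝ → ℝ} (hf : MemLp f 2) (hg : MemLp g 2) :
    inner ℝ hf.toLp hg.toLp = ∫ x, f x * g x := by
  rw [L2.inner_def]
  refine integral_congr_ae ?_
  filter_upwards [hf.coeFn_toLp, hg.coeFn_toLp] with x h1 h2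
  rw [h1, h2]
  simp [mul_comm]

theorem orthonormal_hermiteLp : Orthonormal ℝ hermiteLp := by
  rw [orthonormal_iff_ite]
  intro i j
  rw [hermiteLp, hermiteLp, inner_toLp_toLp, integral_hermiteFun_mul]

theorem span_hermiteLp_orthogonal : (Submodule.span ℝ (Set.range hermiteLp))ᗮ = ⊥ := by
  rw [eq_bot_iff]
  intro f hf
  rw [Submodule.mem_orthogonal] at hf
  rw [Submodule.mem_bot, Lp.eq_zero_iff_ae_eq_zero]
  refine ae_eq_zero_of_forall_integral_mul_hermiteV_eq_zero (Lp.memLp f) fun k => ?_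
  have h := hf (hermiteLp k) (Submodule.subset_span ⟨k, rfl⟩)
  rw [← Lp.toLp_coeFn f (Lp.memLp f), hermiteLp, inner_toLp_toLp] at h
  simp only [hermiteFun_eq, mul_assoc] at h
  rw [integral_const_mul] at h
  rw [← (mul_eq_zero.1 h).resolve_left (hermiteNorm_pos k).ne']
  simp only [mul_comm]

/-- The Parseval identity for the Hermite functions. -/
theorem hasSum_integral_mul_hermiteFun {f g : ℝ → ℝ} (hf : MemLp f 2) (hg : MemLp g 2) :
    HasSum (fun k => (∫ x, f x * hermiteFun k x) * ∫ x, g x * hermiteFun k x)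
      (∫ x, f x * g x) := by
  have h := (HilbertBasis.mkOfOrthogonalEqBot orthonormal_hermiteLp
    span_hermiteLp_orthogonal).hasSum_inner_mul_inner hf.toLp hg.toLp
  rw [HilbertBasis.coe_mkOfOrthogonalEqBot, inner_toLp_toLp] at h
  refine HasSum.congr_fun h fun k => ?_
  rw [hermiteLp, inner_toLp_toLp, inner_toLp_toLp]
  simp only [mul_comm]

/-! ### The Green function and its Hermite coefficients. -/

/-- Up to normalization, the Green function with pole `b` at energy `2n + 1` of the harmonic
oscillator restricted to the functions of parity opposite to `n`. -/
noncomputable def hermiteGreen (n : ℕ) (b x : ℝ) : ℝ :=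
  (Set.Ioi b).indicator (fun x => hermiteU n b * hermiteV n x) x +
    (Set.Ioc (-b) b).indicator (fun x => hermiteV n b * hermiteU n x) x -
    (Set.Iic (-b)).indicator (fun x => hermiteU n b * hermiteV n x) x

theorem continuous_hermiteU (n : ℕ) : Continuous (hermiteU n) :=
  isHermiteLadder_hermiteU.continuous n

theorem memLp_indicator_Ioc {f : ℝ → ℝ} (hf : Continuous f) (a b : ℝ) :
    MemLp ((Set.Ioc a b).indicator f) 2 := by
  rw [memLp_indicator_iff_restrict measurableSet_Ioc,
    memLp_two_iff_integrable_sq hf.aestronglyMeasurable]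
  exact ((hf.pow 2).integrableOn_Icc (a := a) (b := b)).mono_set Set.Ioc_subset_Icc_self

theorem memLp_hermiteGreen (n : ℕ) (b : ℝ) : MemLp (hermiteGreen n b) 2 := by
  have hv := (memLp_hermiteV n).const_mul (hermiteU n b)
  exact ((hv.indicator measurableSet_Ioi).add (memLp_indicator_Ioc
    ((continuous_hermiteU n).const_mul _) _ _)).sub (hv.indicator measurableSet_Iic)

theorem integral_Iic_hermiteV_mul (n k : ℕ) (b : ℝ) :
    ∫ x in Set.Iic (-b), hermiteV n x * hermiteV k x =
      (-1) ^ (n + k) * ∫ x in Set.Ioi b, hermiteV n x * hermiteV k x := by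
  have h := integral_comp_neg_Iic (-b) fun x => hermiteV n x * hermiteV k x
  rw [neg_neg] at h
  rw [← h, ← integral_const_mul]
  refine integral_congr_ae (.of_forall fun x => ?_)
  simp only [hermiteV_neg]
  have : ((-1 : ℝ) ^ (n + k)) ^ 2 = 1 := by rw [← pow_mul, mul_comm, pow_mul]; norm_num
  rw [pow_add] at this ⊢
  linear_combination (-(hermiteV n x * hermiteV k x)) * this

theorem integral_Ioi_hermiteV_mul (n k : ℕ) (b : ℝ) :
    2 * ((n : ℝ) - k) * ∫ x in Set.Ioi b, hermiteV n x * hermiteV k x =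
      hermiteV n b * hermiteV (k + 1) b - hermiteV (n + 1) b * hermiteV k b := by
  rw [← integral_const_mul, integral_Ioi_of_hasDerivAt_of_tendsto'
    (fun x _ => isHermiteLadder_hermiteV.hasDerivAt_wronskian isHermiteLadder_hermiteV n k x)
    ((integrable_hermiteV_mul n k).const_mul _).integrableOn
    (hasGaussianDecay_wronskian_hermiteV n k).tendsto_atTop]
  ring

theorem integral_symm_hermiteU_mul (n k : ℕ) (b : ℝ) :
    2 * ((n : ℝ) - k) * ∫ x in (-b)..b, hermiteU n x * hermiteV k x =
      (1 - (-1) ^ (n + k)) * (hermiteU (n + 1) b * hermiteV k b -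
        hermiteU n b * hermiteV (k + 1) b) := by
  rw [← intervalIntegral.integral_const_mul, intervalIntegral.integral_eq_sub_of_hasDerivAt
    (fun x _ => isHermiteLadder_hermiteU.hasDerivAt_wronskian isHermiteLadder_hermiteV n k x)
    ((continuous_const.mul ((continuous_hermiteU n).mul
      (continuous_hermiteV k))).intervalIntegrable _ _)]
  simp only [hermiteU_neg, hermiteV_neg, pow_succ, pow_add]
  ring

/-- Oddness of the integrand is used directly, since the Wronskian identity says nothing when k = n.
-/
theorem integral_symm_hermiteU_mul_of_even {n k : ℕ} (h : Even (n + k)) (b : ℝ) :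
    ∫ x in (-b)..b, hermiteU n x * hermiteV k x = 0 := by
  have h1 := intervalIntegral.integral_comp_neg (a := -b) (b := b)
    fun x => hermiteU n x * hermiteV k x
  have h2 : ∀ x, hermiteU n (-x) * hermiteV k (-x) = -(hermiteU n x * hermiteV k x) := fun x => by
    rw [hermiteU_neg, hermiteV_neg]
    have := h.neg_one_pow (α := ℝ)
    rw [pow_add] at this
    linear_combination (-(hermiteU n x * hermiteV k x)) * this
  simp only [h2, neg_neg, intervalIntegral.integral_neg] at h1
  linarith

theorem odd_intCast_sub_iff {n k : ℕ} : Odd ((n : ℤ) - k) ↔ Odd (n + k) := by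
  rw [Int.odd_sub, Nat.odd_add, Int.odd_coe_nat, Int.even_coe_nat]

/-- For n - k odd the two outer pieces are equal. Adding the boundary terms at b, those with
V_{k+1}(b) cancel because G is continuous there, and the rest is the Wronskian times V_k(b). -/
theorem integral_hermiteGreen_mul_hermiteV (n k : ℕ) {b : ℝ} (hb : 0 < b) :
    ∫ x, hermiteGreen n b x * hermiteV k x =
      if Odd ((n : ℤ) - k) then -(2 ^ n * n.factorial) * (hermiteV k b / ((n : ℝ) - k)) else 0 := by
  have hint := integrable_hermiteV_mul n k
  have hu : IntegrableOn (fun x => hermiteU n x * hermiteV k x) (Set.Ioc (-b) b) :=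
    (((continuous_hermiteU n).mul (continuous_hermiteV k)).integrableOn_Icc
      (a := -b) (b := b)).mono_set Set.Ioc_subset_Icc_self
  have hsplit : ∫ x, hermiteGreen n b x * hermiteV k x =
      hermiteU n b * (∫ x in Set.Ioi b, hermiteV n x * hermiteV k x) +
      hermiteV n b * (∫ x in (-b)..b, hermiteU n x * hermiteV k x) -
      hermiteU n b * ∫ x in Set.Iic (-b), hermiteV n x * hermiteV k x := by
    have : ∀ x, hermiteGreen n b x * hermiteV k x =
        hermiteU n b * (Set.Ioi b).indicator (fun x => hermiteV n x * hermiteV k x) x +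
        hermiteV n b * (Set.Ioc (-b) b).indicator (fun x => hermiteU n x * hermiteV k x) x -
        hermiteU n b * (Set.Iic (-b)).indicator (fun x => hermiteV n x * hermiteV k x) x := by
      intro x
      simp only [hermiteGreen, Set.indicator_apply]
      split_ifs <;> ring
    simp only [this]
    have i1 := (hint.indicator (measurableSet_Ioi (a := b))).const_mul (hermiteU n b)
    have i2 := (hu.integrable_indicator measurableSet_Ioc).const_mul (hermiteV n b)
    have i3 := (hint.indicator (measurableSet_Iic (a := -b))).const_mul (hermiteU n b)
    rw [integral_sub (by exact i1.add i2) i3, integral_add i1 i2, integral_const_mul, integral_const_mul,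
      integral_const_mul, integral_indicator measurableSet_Ioi,
      integral_indicator measurableSet_Ioc, integral_indicator measurableSet_Iic,
      intervalIntegral.integral_of_le (by linarith)]
  rw [hsplit, integral_Iic_hermiteV_mul]
  split_ifs with h
  · have hodd := odd_intCast_sub_iff.1 h
    have hA := integral_Ioi_hermiteV_mul n k b
    have hB := integral_symm_hermiteU_mul n k b
    have hW := hermiteU_hermiteV_wronskian n b
    have hnk : (n : ℝ) - k ≠ 0 := by
      rintro h0
      have : (n : ℤ) - k = 0 := by exact_mod_cast h0
      rw [this] at h
      exact absurd h (by decide)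
    rw [hodd.neg_one_pow] at hB ⊢
    rw [mul_div_assoc', eq_div_iff hnk]
    linear_combination hermiteU n b * hA + hermiteV n b / 2 * hB + hermiteV k b * hW
  · have heven : Even (n + k) := by
      rw [← Nat.not_odd_iff_even, ← odd_intCast_sub_iff]
      exact h
    rw [integral_symm_hermiteU_mul_of_even heven, heven.neg_one_pow]
    ring

/-- Parseval for G against the indicator of (b, x], where G is a multiple of V_n. -/
theorem hasSum_intervalIntegral_hermiteGreen (n : ℕ) {b x : ℝ} (hb : 0 < b) (hx : b ≤ x) :
    HasSum (fun k : ℕ => (if Odd ((n : ℤ) - k) then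
        -(2 ^ n * n.factorial) * (hermiteFun k b / ((n : ℝ) - k)) else 0) *
        ∫ t in b..x, hermiteFun k t)
      (∫ t in b..x, hermiteU n b * hermiteV n t) := by
  have h := hasSum_integral_mul_hermiteFun (memLp_hermiteGreen n b)
    (memLp_indicator_Ioc (continuous_const (y := (1 : ℝ))) b x)
  have h1 : ∫ t, hermiteGreen n b t * (Set.Ioc b x).indicator (fun _ => (1 : ℝ)) t =
      ∫ t in b..x, hermiteU n b * hermiteV n t := by
    rw [intervalIntegral.integral_of_le hx, ← integral_indicator measurableSet_Ioc]
    congr 1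
    ext t
    simp only [hermiteGreen, Set.indicator_apply, Set.mem_Ioi, Set.mem_Ioc, Set.mem_Iic]
    by_cases ht : b < t ∧ t ≤ x
    · have h1 : ¬ t ≤ b := not_le.2 ht.1
      have h2 : ¬ t ≤ -b := by linarith [ht.1]
      simp [ht, h1, h2]
    · simp [ht]
  rw [h1] at h
  refine HasSum.congr_fun h fun k => ?_
  congr 1
  · simp only [hermiteFun_eq, mul_left_comm _ (hermiteNorm k)]
    rw [integral_const_mul, integral_hermiteGreen_mul_hermiteV n k hb]
    split_ifs
    · ring
    · simp
  · rw [intervalIntegral.integral_of_le hx, ← integral_indicator measurableSet_Ioc]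
    congr 1
    ext t
    simp only [Set.indicator_apply]
    split_ifs <;> simp

/-! ### Summability and the closed form. -/

/-- Bounds uniform on [b, b + 1] serve as the dominating sequence for the averages. The finitely
many small k are covered by compactness alone. -/
theorem exists_bound_hermiteFun {b : ℝ} (hb : 0 < b) : ∃ M : ℕ → ℝ,
    (∀ k, ∀ x ∈ Set.Icc b (b + 1), |hermiteFun k x| ≤ M k) ∧
    ∀ k : ℕ, (b + 1) ^ 2 ≤ k → M k ^ 2 ≤ 4 / √(k + 1) := by
  have (k : ℕ) : ∃ m, (∀ x ∈ Set.Icc b (b + 1), |hermiteFun k x| ≤ m) ∧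
      ((b + 1) ^ 2 ≤ k → m ^ 2 ≤ 4 / √(k + 1)) := by
    by_cases hk : (b + 1) ^ 2 ≤ k
    · refine ⟨√(4 / √(k + 1)), fun x hx => ?_, fun _ => (sq_sqrt (by positivity)).le⟩
      refine abs_le_sqrt (hermiteFun_sq_le (hb.le.trans hx.1) ?_)
      exact (pow_le_pow_left₀ (hb.le.trans hx.1) hx.2 2).trans hk
    · obtain ⟨m, hm⟩ := (isCompact_Icc (a := b) (b := b + 1)).exists_bound_of_continuousOn
        (continuous_hermiteFun k).continuousOn
      exact ⟨m, hm, fun h => absurd h hk⟩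
  choose M hM using this
  exact ⟨M, fun k => (hM k).1, fun k => (hM k).2⟩

theorem summable_one_div_mul_sqrt : Summable fun k : ℕ => 1 / (((k : ℝ) + 1) * √(k + 1)) := by
  have h := (summable_nat_add_iff 1).2
    (Real.summable_one_div_nat_rpow (p := 3 / 2).2 (by norm_num))
  refine h.congr fun k => ?_
  have hk : (0 : ℝ) < k + 1 := by positivity
  rw [sqrt_eq_rpow, show (3 / 2 : ℝ) = 1 + 1 / 2 by norm_num]
  push_cast
  rw [rpow_add hk, rpow_one]

/-- Comparison with k^{-3/2}. For k ≥ 2n + 1 one has k - n ≥ (k + 1)/2, hence the constant 8; the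
term k = n is 0 since division by zero gives 0. -/
theorem summable_div_abs_sub {a : ℕ → ℝ} (n : ℕ) {K : ℝ} (ha : ∀ k, 0 ≤ a k)
    (hK : ∀ k : ℕ, K ≤ k → a k ≤ 4 / √(k + 1)) :
    Summable fun k : ℕ => a k / |(n : ℝ) - k| := by
  refine summable_of_isBigO_nat summable_one_div_mul_sqrt (Asymptotics.IsBigO.of_bound 8 ?_)
  filter_upwards [eventually_ge_atTop (2 * n + 1), eventually_ge_atTop ⌈K⌉₊] with k hk hk'
  have h1 : (2 * n + 1 : ℝ) ≤ k := by exact_mod_cast hk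
  have hn : (0 : ℝ) ≤ n := n.cast_nonneg
  have h2 := hK k (Nat.ceil_le.1 hk')
  have h3 : |(n : ℝ) - k| = k - n := by
    rw [abs_sub_comm, abs_of_nonneg (by linarith)]
  rw [h3, norm_of_nonneg (div_nonneg (ha k) (by linarith)), norm_of_nonneg (by positivity)]
  calc a k / (k - n) ≤ (4 / √(k + 1)) / ((k + 1) / 2) := by
        gcongr
        linarith
    _ = _ := by
        field_simp
        norm_num

theorem tendsto_average_right {f : ℝ → ℝ} (hf : Continuous f) (b : ℝ) :
    Tendsto (fun ε => ε⁻¹ * ∫ t in b..(b + ε), f t) (𝓝[>] 0) (𝓝 (f b)) := by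
  have h := intervalIntegral.integral_hasDerivAt_right (hf.intervalIntegrable b b)
    (hf.stronglyMeasurableAtFilter _ _) hf.continuousAt
  rw [hasDerivAt_iff_tendsto_slope_zero] at h
  refine (h.mono_left (nhdsWithin_mono _ fun x hx => (ne_of_gt hx))).congr fun ε => ?_
  simp

theorem summable_sigmaTildeTerm {b : ℝ} (hb : 0 < b) (n : ℕ) :
    Summable fun k => sigmaTildeTerm b n k := by
  obtain ⟨M, hM, hM'⟩ := exists_bound_hermiteFun hb
  refine Summable.of_norm_bounded (summable_div_abs_sub n (fun k => sq_nonneg (M k)) hM')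
    fun k => ?_
  rw [sigmaTildeTerm]
  split_ifs
  · rw [norm_eq_abs, abs_div, abs_pow]
    gcongr
    exact hM k b ⟨le_rfl, by linarith⟩
  · rw [norm_zero]
    positivity

/-- Closed form of `σ̃(n)`. -/
theorem sigmaTilde_eq {b : ℝ} (hb : 0 < b) (n : ℕ) :
    sigmaTilde b n = hermiteU n b * hermiteV n b / -(2 ^ n * n.factorial) := by
  obtain ⟨M, hM, hM'⟩ := exists_bound_hermiteFun hb
  have hW : (-(2 ^ n * n.factorial) : ℝ) ≠ 0 := by
    have := n.factorial_pos
    exact neg_ne_zero.2 (by positivity)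
  set W : ℝ := -(2 ^ n * n.factorial)
  set c : ℕ → ℝ := fun k => if Odd ((n : ℤ) - k) then W * (hermiteFun k b / ((n : ℝ) - k)) else 0
    with hc
  have hbd (k : ℕ) : |c k| ≤ |W| * (M k / |(n : ℝ) - k|) := by
    have hMk := hM k b ⟨le_rfl, by linarith⟩
    have hMk0 := (abs_nonneg _).trans hMk
    simp only [hc]
    split_ifs
    · rw [abs_mul, abs_div]
      gcongr
    · rw [abs_zero]
      positivity
  -- As ε → 0 the averages tend to h_k(b) while staying below M_k, so the averaged Parseval series
  -- tends to the series at b.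
  have hlim := tendsto_tsum_of_dominated_convergence (𝓕 := 𝓝[>] (0 : ℝ))
    (f := fun ε k => c k * (ε⁻¹ * ∫ t in b..(b + ε), hermiteFun k t))
    (g := fun k => c k * hermiteFun k b)
    (bound := fun k => |W| * (M k ^ 2 / |(n : ℝ) - k|))
    ((summable_div_abs_sub n (fun k => sq_nonneg (M k)) hM').mul_left _)
    (fun k => (tendsto_average_right (continuous_hermiteFun k) b).const_mul _)
    (by
      filter_upwards [Ioc_mem_nhdsGT (zero_lt_one' ℝ)] with ε hε k
      have hi : ‖∫ t in b..(b + ε), hermiteFun k t‖ ≤ M k * |b + ε - b| := by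
        refine intervalIntegral.norm_integral_le_of_norm_le_const fun x hx => ?_
        rw [Set.uIoc_of_le (by linarith [hε.1])] at hx
        exact hM k x ⟨hx.1.le, by linarith [hx.2, hε.2]⟩
      rw [add_sub_cancel_left, abs_of_pos hε.1, norm_eq_abs] at hi
      have hMk0 := (abs_nonneg _).trans (hM k b ⟨le_rfl, by linarith⟩)
      have hε0 := hε.1
      rw [norm_eq_abs, abs_mul, abs_mul, abs_inv, abs_of_pos hε.1]
      calc _ ≤ |W| * (M k / |(n : ℝ) - k|) * (ε⁻¹ * (M k * ε)) := by
            gcongr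
            exact hbd k
        _ = _ := by
            field_simp)
  have hlim' := (tendsto_average_right ((continuous_hermiteV n).const_mul (hermiteU n b)) b)
  have hsum : ∑' k, c k * hermiteFun k b = W * sigmaTilde b n := by
    rw [sigmaTilde, ← tsum_mul_left]
    refine tsum_congr fun k => ?_
    simp only [hc, sigmaTildeTerm]
    split_ifs <;> ring
  rw [hsum] at hlim
  rw [eq_div_iff hW, mul_comm]
  refine tendsto_nhds_unique hlim (hlim'.congr' ?_)
  filter_upwards [self_mem_nhdsWithin] with ε hε
  have h := (hasSum_intervalIntegral_hermiteGreen n hb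
    (by linarith [Set.mem_Ioi.1 hε] : b ≤ b + ε)).mul_left ε⁻¹
  exact ((tsum_congr fun k => mul_left_comm _ _ _).trans h.tsum_eq).symm

end HermiteExpansion

/-! ### The asymptotic formula. -/

theorem mainTheorem5 (b : ℝ) (hb : 0 < b) :
    (∀ n : ℕ, Summable (fun k : ℕ => sigmaTildeTerm b n k)) ∧
    ∃ C : ℝ, ∀ n : ℕ, 2 ≤ n →
      |sigmaTilde b n - (-1) ^ (n + 1) * sin (2 * b * √(2 * (n : ℝ))) / (2 * √(2 * (n : ℝ)))|
        ≤ C * (Real.log (n : ℝ) / (n : ℝ)) := by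
  refine ⟨summable_sigmaTildeTerm hb, ?_⟩
  set r : ℕ → ℝ := fun n =>
    |sigmaTilde b n - (-1) ^ (n + 1) * sin (2 * b * √(2 * (n : ℝ))) / (2 * √(2 * (n : ℝ)))|
  have hlarge : ∀ n : ℕ, 0 < n → b ^ 2 ≤ n → n * r n ≤ 5 * (b ^ 2 + 1) * b := by
    intro n hn hbn
    have h := abs_hermiteU_mul_hermiteV_sub_le hn hb.le hbn
    rw [← sigmaTilde_eq hb, le_div_iff₀ (by exact_mod_cast hn)] at h
    linarith
  -- The asymptotic bound needs b² ≤ n; the finitely many smaller n are absorbed into the constant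
  -- through S.
  set S : ℝ := ∑ n ∈ Finset.range ⌈b ^ 2⌉₊, n * r n
  have hr (n : ℕ) : 0 ≤ n * r n := mul_nonneg n.cast_nonneg (abs_nonneg _)
  have hS : 0 ≤ S := Finset.sum_nonneg fun n _ => hr n
  have hall : ∀ n : ℕ, 0 < n → n * r n ≤ 5 * (b ^ 2 + 1) * b + S := by
    intro n hn
    by_cases hbn : b ^ 2 ≤ n
    · linarith [hlarge n hn hbn]
    · have h1 : n * r n ≤ S := Finset.single_le_sum (f := fun n : ℕ => n * r n)
        (fun i _ => hr i) (Finset.mem_range.2 (Nat.lt_ceil.2 (not_le.1 hbn)))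
      have : 0 ≤ 5 * (b ^ 2 + 1) * b := by positivity
      linarith
  -- For n ≥ 2 the bound 1/n is at most (log n / n) / log 2.
  refine ⟨(5 * (b ^ 2 + 1) * b + S) / Real.log 2, fun n hn => ?_⟩
  have hn0 : (0 : ℝ) < n := by exact_mod_cast (by omega : 0 < n)
  have hlog2 : 0 < Real.log 2 := Real.log_pos (by norm_num)
  have hlog : Real.log 2 ≤ Real.log n := Real.log_le_log (by norm_num) (by exact_mod_cast hn)
  have h := hall n (by omega)
  have hC : 0 ≤ 5 * (b ^ 2 + 1) * b + S := (hr n).trans h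
  calc r n ≤ (5 * (b ^ 2 + 1) * b + S) / n := by
        rw [le_div_iff₀ hn0]
        linarith
    _ = (5 * (b ^ 2 + 1) * b + S) / Real.log 2 * (Real.log 2 / n) := by field_simp
    _ ≤ _ := by gcongr
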